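/- Let $X$ be a diffeological space and $x\in X$. For a $D$-open set $B\ni x$ (one whose preimage under every plot is open), equip $B$ with the sub-diffeology and the algebra $C^\infty(B,\mathbb R)$ of smooth functions $B\to\mathbb R$ with the functional diffeology (a map $p:U\to C^\infty(B,\mathbb R)$ is a plot iff $(u,b)\mapsto p(u)(b)$ is smooth on $U\times B$). Let $G_x(X)=\operatorname{colim}_{B} C^\infty(B,\mathbb R)$, the colimit in diffeological spaces along restrictions over all $D$-open $B\ni x$, be the diffeological $\mathbb R$-algebra of germs at $x$. The external tangent space $\hat T_x(X)$ is the real vector space of smooth linear maps $F:G_x(X)\to\mathbb R$ with $F([f][g])=F([f])\,g(x)+f(x)\,F([g])$. A smooth map $f:X\to Y$ induces the linear map $f_*:\hat T_x(X)\to\hat T_{f(x)}(Y)$, $f_*(F)([g])=F([g\circ f])$, where $g \circ f$ is defined on the preimage of the domain of $g$. Let $X'$ be the set $X$ with the diffeology generated by $C^\infty(\mathbb R,X)$, and let $\iota:X'\to X$ be the natural smooth map (the identity on points). Then $\iota_*:\hat T_x(X')\to\hat T_x(X)$ is an isomorphism of vector spaces. Consequently the external tangent space depends only on the one-dimensional plots: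 if $Y$ is a diffeological space and $\varphi:X\to Y$ is a bijection such that a map $c:\mathbb R\to X$ is smooth if and only if $\varphi\circ c$ is smooth, then $\varphi\circ\iota:X'\to Y$ is smooth and there is a linear isomorphism $e:\hat T_x(X)\to\hat T_{\varphi(x)}(Y)$ with $e\circ\iota_*=(\varphi\circ\iota)_*$. -/

import Mathlib

open scoped ContDiff Topology
open Diffeology

noncomputable section

namespace ExternalTangent

/-! ## Sub-diffeology, product diffeology, smooth functions -/

/-- The diffeology induced on `A` by a map `f : A → Y`: a map into `A` is a plot iff its
composite with `f` is a plot of `Y`. -/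
@[reducible]
def inducedDiffeology {A Y : Type*} [DiffeologicalSpace Y] (f : A → Y) : DiffeologicalSpace A where
  plots n := {p | IsPlot (f ∘ p)}
  constant_plots a := isPlot_const (x := f a)
  plot_reparam hp hf := isPlot_reparam (X := Y) hp hf
  locality hp := DiffeologicalSpace.locality (X := Y) fun t ↦
    let ⟨u, hu, htu, h⟩ := hp t
    ⟨u, hu, htu, fun hfu hf ↦ h hfu hf⟩

/-- The sub-diffeology on a subset. -/
instance subDiffeology {X : Type*} [DiffeologicalSpace X] (B : Set X) : DiffeologicalSpace B :=
  inducedDiffeology (Subtype.val : B → X)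

/-- The product diffeology: a map into `X × Y` is a plot iff both components are plots. -/
@[reducible]
def prodDiffeology (X Y : Type*) [DiffeologicalSpace X] [DiffeologicalSpace Y] :
    DiffeologicalSpace (X × Y) where
  plots _ := {p | IsPlot (Prod.fst ∘ p) ∧ IsPlot (Prod.snd ∘ p)}
  constant_plots z := ⟨isPlot_const (x := z.1), isPlot_const (x := z.2)⟩
  plot_reparam hp hf := ⟨isPlot_reparam (X := X) hp.1 hf, isPlot_reparam (X := Y) hp.2 hf⟩
  locality hp := by
    refine ⟨DiffeologicalSpace.locality (X := X) fun t ↦ ?_,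
      DiffeologicalSpace.locality (X := Y) fun t ↦ ?_⟩
    · obtain ⟨u, hu, htu, h⟩ := hp t
      exact ⟨u, hu, htu, fun hfu hf ↦ (h hfu hf).1⟩
    · obtain ⟨u, hu, htu, h⟩ := hp t
      exact ⟨u, hu, htu, fun hfu hf ↦ (h hfu hf).2⟩

attribute [local instance] prodDiffeology

/-- `C^∞(X, ℝ)`, as an algebra under the pointwise operations. -/
def smoothFunctions (X : Type*) [DiffeologicalSpace X] : Subalgebra ℝ (X → ℝ) where
  carrier := {f | DSmooth f}
  mul_mem' hf hg n p hp := ((hf n p hp).contDiff.mul (hg n p hp).contDiff).isPlot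
  add_mem' hf hg n p hp := ((hf n p hp).contDiff.add (hg n p hp).contDiff).isPlot
  algebraMap_mem' r := dSmooth_const (y := r)

/-- The functional diffeology on `C^∞(X, ℝ)`: a map `p : ℝⁿ → C^∞(X, ℝ)` is a plot iff
`(u, a) ↦ p u a` is smooth on `ℝⁿ × X`. -/
instance functionalDiffeology (X : Type*) [DiffeologicalSpace X] :
    DiffeologicalSpace (smoothFunctions X) where
  plots n := {p | DSmooth fun z : EuclideanSpace ℝ (Fin n) × X ↦ (p z.1 : X → ℝ) z.2}
  constant_plots f := fun m q hq ↦ f.2 m (Prod.snd ∘ q) hq.2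
  plot_reparam {n m p f} hp hf := fun k q hq ↦
    hp k (fun t ↦ (f (q t).1, (q t).2)) ⟨hf.isPlot.dSmooth _ _ hq.1, hq.2⟩
  locality {n p} hp := fun m q hq ↦ by
    have hq₁ : ContDiff ℝ ∞ (Prod.fst ∘ q) := IsPlot.contDiff hq.1
    refine DiffeologicalSpace.locality fun t ↦ ?_
    obtain ⟨u, hu, htu, h⟩ := hp (q t).1
    refine ⟨(Prod.fst ∘ q) ⁻¹' u, hu.preimage hq₁.continuous, htu, fun {k f} hfu hf ↦ ?_⟩
    exact h (f := (Prod.fst ∘ q) ∘ f) hfu (hq₁.comp hf) k (fun s ↦ (s, (q (f s)).2))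
      ⟨isPlot_id, isPlot_reparam (X := X) hq.2 hf⟩

/-- Pullback of smooth functions along a smooth map, `g ↦ g ∘ f`. -/
def smoothFunctions.comp {X Y : Type*} [DiffeologicalSpace X] [DiffeologicalSpace Y]
    (f : X → Y) (hf : DSmooth f) : smoothFunctions Y →ₐ[ℝ] smoothFunctions X where
  toFun g := ⟨g.1 ∘ f, g.2.comp hf⟩
  map_one' := rfl
  map_mul' _ _ := rfl
  map_zero' := rfl
  map_add' _ _ := rfl
  commutes' _ := rfl

theorem smoothFunctions.dSmooth_comp {X Y : Type*} [DiffeologicalSpace X] [DiffeologicalSpace Y]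
    (f : X → Y) (hf : DSmooth f) : DSmooth (smoothFunctions.comp f hf) :=
  fun _ _ hp m q hq ↦ hp m (fun t ↦ ((q t).1, f (q t).2)) ⟨hq.1, hf _ _ hq.2⟩

/-! ## Germs of smooth functions -/

/-- The `D`-open subsets of `X` containing `x`. -/
structure DOpenNhd (X : Type*) [DiffeologicalSpace X] (x : X) where
  carrier : Set X
  isOpen : IsOpen[DiffeologicalSpace.dTopology] carrier
  mem : x ∈ carrier

namespace DOpenNhd

variable {X : Type*} [DiffeologicalSpace X] {x : X}

/-- Neighbourhoods are ordered by reverse inclusion. -/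
instance : Preorder (DOpenNhd X x) where
  le B C := C.carrier ⊆ B.carrier
  le_refl _ := subset_rfl
  le_trans _ _ _ h₁ h₂ := h₂.trans h₁

instance : Nonempty (DOpenNhd X x) :=
  ⟨⟨Set.univ, @isOpen_univ X DiffeologicalSpace.dTopology, trivial⟩⟩

instance : IsDirectedOrder (DOpenNhd X x) where
  directed B C := ⟨⟨B.carrier ∩ C.carrier,
    @IsOpen.inter X DiffeologicalSpace.dTopology _ _ B.isOpen C.isOpen, B.mem, C.mem⟩,
    Set.inter_subset_left, Set.inter_subset_right⟩

/-- The preimage of a neighbourhood under a smooth map. -/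
def preimage {Y : Type*} [DiffeologicalSpace Y] (f : X → Y) (hf : DSmooth f) (x : X)
    (B : DOpenNhd Y (f x)) : DOpenNhd X x :=
  ⟨f ⁻¹' B.carrier, @IsOpen.preimage X Y DiffeologicalSpace.dTopology DiffeologicalSpace.dTopology
    f hf.continuous _ B.isOpen, B.mem⟩

/-- The restriction map `C^∞(B, ℝ) → C^∞(C, ℝ)` for `C ⊆ B`. -/
def restrict (B C : DOpenNhd X x) (h : B ≤ C) :
    smoothFunctions B.carrier →ₐ[ℝ] smoothFunctions C.carrier :=
  smoothFunctions.comp (Set.inclusion h) fun _ _ hp ↦ hp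

instance : DirectedSystem (fun B : DOpenNhd X x ↦ smoothFunctions B.carrier)
    fun B C h ↦ (restrict B C h : smoothFunctions B.carrier → smoothFunctions C.carrier) where
  map_self _ _ := rfl
  map_map _ _ _ _ _ _ := rfl

end DOpenNhd

section

variable (X : Type*) [DiffeologicalSpace X] (x : X)

/-- The algebra `G_x(X)` of germs at `x` of smooth functions: the colimit of the algebras
`C^∞(B, ℝ)` along restrictions, `B` running over the `D`-open sets containing `x`. -/
def Germs : Type _ :=
  DirectLimit (fun B : DOpenNhd X x ↦ smoothFunctions B.carrier) DOpenNhd.restrict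

instance : CommRing (Germs X x) :=
  inferInstanceAs (CommRing (DirectLimit (fun B : DOpenNhd X x ↦ smoothFunctions B.carrier)
    DOpenNhd.restrict))

instance : Algebra ℝ (Germs X x) :=
  inferInstanceAs (Algebra ℝ (DirectLimit (fun B : DOpenNhd X x ↦ smoothFunctions B.carrier)
    DOpenNhd.restrict))

end

namespace Germs

variable {X : Type*} [DiffeologicalSpace X] {x : X}

/-- The germ at `x` of a smooth function defined on the `D`-open set `B`. -/
def mk (B : DOpenNhd X x) : smoothFunctions B.carrier →ₐ[ℝ] Germs X x :=
  DirectLimit.Algebra.of (fun B : DOpenNhd X x ↦ smoothFunctions B.carrier) DOpenNhd.restrict B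

/-- Algebra maps out of the colimit. -/
def lift {A : Type*} [CommRing A] [Algebra ℝ A]
    (g : ∀ B : DOpenNhd X x, smoothFunctions B.carrier →ₐ[ℝ] A)
    (hg : ∀ (B C : DOpenNhd X x) (h : B ≤ C) (φ : smoothFunctions B.carrier),
      g C (DOpenNhd.restrict B C h φ) = g B φ) : Germs X x →ₐ[ℝ] A :=
  DirectLimit.Algebra.lift (fun B : DOpenNhd X x ↦ smoothFunctions B.carrier) DOpenNhd.restrict
    A g hg

theorem lift_mk {A : Type*} [CommRing A] [Algebra ℝ A]
    (g : ∀ B : DOpenNhd X x, smoothFunctions B.carrier →ₐ[ℝ] A)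
    (hg : ∀ (B C : DOpenNhd X x) (h : B ≤ C) (φ : smoothFunctions B.carrier),
      g C (DOpenNhd.restrict B C h φ) = g B φ) (B : DOpenNhd X x) (φ : smoothFunctions B.carrier) :
    lift g hg (mk B φ) = g B φ := rfl

theorem exists_mk (a : Germs X x) :
    ∃ (B : DOpenNhd X x) (φ : smoothFunctions B.carrier), mk B φ = a := by
  obtain ⟨B, φ, h⟩ := DirectLimit.exists_eq_mk _ a
  exact ⟨B, φ, h.symm⟩

theorem mk_restrict (B C : DOpenNhd X x) (h : B ≤ C) (φ : smoothFunctions B.carrier) :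
    mk C (DOpenNhd.restrict B C h φ) = mk B φ :=
  DirectLimit.Algebra.of_f (G := fun B : DOpenNhd X x ↦ smoothFunctions B.carrier)
    (f := DOpenNhd.restrict) h φ

/-- Two smooth functions have the same germ at `x` iff they agree on a `D`-open set
containing `x`. -/
theorem mk_eq_mk_iff (B C : DOpenNhd X x) (φ : smoothFunctions B.carrier)
    (ψ : smoothFunctions C.carrier) :
    mk B φ = mk C ψ ↔ ∃ (D : DOpenNhd X x) (hB : B ≤ D) (hC : C ≤ D),
      DOpenNhd.restrict B D hB φ = DOpenNhd.restrict C D hC ψ :=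
  Quotient.eq (r := DirectLimit.setoid
    (F := fun B : DOpenNhd X x ↦ smoothFunctions B.carrier) DOpenNhd.restrict)

/-- The colimit diffeology on `G_x(X)`: the smallest one for which all the maps
`C^∞(B, ℝ) → G_x(X)` are smooth. -/
instance : DiffeologicalSpace (Germs X x) :=
  DiffeologicalSpace.generateFrom {p | ∃ (B : DOpenNhd X x) (n : ℕ)
    (q : EuclideanSpace ℝ (Fin n) → smoothFunctions B.carrier), IsPlot q ∧ p = ⟨n, mk B ∘ q⟩}

theorem dSmooth_mk (B : DOpenNhd X x) : DSmooth (mk B) :=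
  fun _ q hq ↦ DiffeologicalSpace.isPlot_generatedFrom_of_mem ⟨B, _, q, hq, rfl⟩

/-- A map out of `G_x(X)` is smooth as soon as it is smooth on every `C^∞(B, ℝ)`. -/
theorem dSmooth_of_mk {Z : Type*} [DiffeologicalSpace Z] {F : Germs X x → Z}
    (hF : ∀ B, DSmooth (F ∘ mk B)) : DSmooth F := fun _ _ hp ↦
  hp (inducedDiffeology F) (by rintro _ ⟨B, n, q, hq, rfl⟩; exact hF B n q hq)

/-- Evaluation of germs, `[f] ↦ f(x)`. -/
def eval (x : X) : Germs X x →ₐ[ℝ] ℝ :=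
  lift (fun B ↦ (Pi.evalAlgHom ℝ (fun _ : B.carrier ↦ ℝ) ⟨x, B.mem⟩).comp
    (smoothFunctions B.carrier).val) fun _ _ _ _ ↦ rfl

/-- For a smooth map `f` and a smooth function `g` on `B`, the function `g ∘ f` on `f⁻¹(B)`. -/
def pullbackOn {Y : Type*} [DiffeologicalSpace Y] (f : X → Y) (hf : DSmooth f) (x : X)
    (B : DOpenNhd Y (f x)) :
    smoothFunctions B.carrier →ₐ[ℝ] smoothFunctions (B.preimage f hf x).carrier :=
  smoothFunctions.comp (fun a : (B.preimage f hf x).carrier ↦ (⟨f a.1, a.2⟩ : B.carrier))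
    fun n p hp ↦ hf n (Subtype.val ∘ p) hp

/-- Pullback of germs, `[g] ↦ [g ∘ f]`, where `g` is defined on `B` and `g ∘ f` on `f⁻¹(B)`. -/
def pullback {Y : Type*} [DiffeologicalSpace Y] (f : X → Y) (hf : DSmooth f) (x : X) :
    Germs Y (f x) →ₐ[ℝ] Germs X x :=
  lift (fun B ↦ (mk (B.preimage f hf x)).comp (pullbackOn f hf x B)) fun B C h φ ↦
    mk_restrict (B.preimage f hf x) (C.preimage f hf x) (Set.preimage_mono (f := f) h)
      (pullbackOn f hf x B φ)

theorem pullback_mk {Y : Type*} [DiffeologicalSpace Y] (f : X → Y) (hf : DSmooth f) (x : X)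
    (B : DOpenNhd Y (f x)) (φ : smoothFunctions B.carrier) :
    pullback f hf x (mk B φ) = mk (B.preimage f hf x) (pullbackOn f hf x B φ) := rfl

theorem dSmooth_pullback {Y : Type*} [DiffeologicalSpace Y] (f : X → Y) (hf : DSmooth f) (x : X) :
    DSmooth (pullback f hf x) :=
  dSmooth_of_mk fun B ↦ DSmooth.comp (g := mk (B.preimage f hf x)) (f := pullbackOn f hf x B)
    (dSmooth_mk (B.preimage f hf x)) (smoothFunctions.dSmooth_comp _ _)

theorem eval_pullback {Y : Type*} [DiffeologicalSpace Y] (f : X → Y) (hf : DSmooth f) (x : X)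
    (a : Germs Y (f x)) : eval x (pullback f hf x a) = eval (f x) a := by
  obtain ⟨B, φ, rfl⟩ := exists_mk a
  rfl

end Germs

/-! ## The external tangent space -/

/-- The external tangent space of `X` at `x`: the smooth linear maps `F : G_x(X) → ℝ` with
`F([f][g]) = F([f]) g(x) + f(x) F([g])`. -/
def ExternalTangentSpace (X : Type*) [DiffeologicalSpace X] (x : X) :
    Submodule ℝ (Germs X x →ₗ[ℝ] ℝ) where
  carrier := {F | DSmooth F ∧
    ∀ a b : Germs X x, F (a * b) = F a * Germs.eval x b + Germs.eval x a * F b}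
  zero_mem' := ⟨dSmooth_const (y := (0 : ℝ)), fun _ _ ↦ by simp⟩
  add_mem' {F G} hF hG :=
    ⟨fun n p hp ↦ ((hF.1 n p hp).contDiff.add (hG.1 n p hp).contDiff).isPlot, fun a b ↦ by
      simp only [LinearMap.add_apply, hF.2, hG.2]; ring⟩
  smul_mem' c F hF :=
    ⟨fun n p hp ↦ (contDiff_const.mul (hF.1 n p hp).contDiff).isPlot (p := fun t ↦ c * F (p t)),
      fun a b ↦ by simp only [LinearMap.smul_apply, smul_eq_mul, hF.2]; ring⟩

/-- The linear map `f_* : T̂_x(X) → T̂_{f(x)}(Y)`, `f_*(F)([g]) = F([g ∘ f])`, induced by a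
smooth map `f`. -/
def ExternalTangentSpace.map {X Y : Type*} [DiffeologicalSpace X] [DiffeologicalSpace Y]
    (f : X → Y) (hf : DSmooth f) (x : X) :
    ExternalTangentSpace X x →ₗ[ℝ] ExternalTangentSpace Y (f x) where
  toFun F := ⟨F.1 ∘ₗ (Germs.pullback f hf x).toLinearMap,
    F.2.1.comp (Germs.dSmooth_pullback f hf x), fun a b ↦ by
      simp only [LinearMap.comp_apply, AlgHom.toLinearMap_apply, map_mul, F.2.2,
        Germs.eval_pullback]⟩
  map_add' _ _ := rfl
  map_smul' _ _ := rfl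

/-! ## The diffeology generated by the smooth curves -/

/-- The set `X` with the diffeology generated by `C^∞(ℝ, X)`. -/
def CurveGenerated (X : Type*) : Type _ := X

namespace CurveGenerated

variable {X : Type*} [DiffeologicalSpace X]

/-- Plots are indexed by `EuclideanSpace ℝ (Fin n)`, so that a curve `c : ℝ → X` appears as
`t ↦ c (t 0)`. -/
instance : DiffeologicalSpace (CurveGenerated X) :=
  DiffeologicalSpace.generateFrom (X := X)
    {p | ∃ c : ℝ → X, DSmooth c ∧ p = ⟨1, fun t ↦ c (t 0)⟩}

/-- The natural map `X' → X`, the identity on points. -/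
def toOriginal (X : Type*) : CurveGenerated X → X := fun x ↦ x

theorem dSmooth_toOriginal : DSmooth (toOriginal X) := fun _ _ hp ↦ by
  refine hp ‹DiffeologicalSpace X› ?_
  rintro _ ⟨c, hc, rfl⟩
  refine hc 1 (fun t ↦ t 0) (ContDiff.isPlot ?_)
  fun_prop

end CurveGenerated

end ExternalTangent

end

/-!
A bijection `f : X → Y` that is smooth and has the same smooth curves as its target
(`f ∘ c` smooth implies `c` smooth) induces an isomorphism of external tangent spaces
(`ExternalTangentSpace.map_bijective`). Both parts of the theorem are instances of this, applied to
`ι : X' → X` and to `φ ∘ ι : X' → Y`.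

The reason is that everything entering the external tangent space is determined by smooth curves.
The `D`-open sets are (`isOpen_dTopology_of_forall_curve`), and so are the smooth real-valued
functions (`dSmooth_of_forall_curve`). The latter also applies to the functions on `ℝⁿ × B` which
define the functional diffeology of `C^∞(B, ℝ)`. So pullback along `f` is a bijection of germ
algebras with smooth inverse, although the inverse of `f` itself need not be smooth.

The analytic input is Boman's theorem (`contDiff_of_forall_curve`): a function on a Euclidean space
is smooth if its composites with all smooth curves are. By the special curve lemma
(`exists_contDiff_curve`), any fast converging sequence of points, with prescribed fast decreasing
velocities, lies on a smooth curve. Hence such a function is continuous, and its iterated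
derivatives in each fixed direction are locally bounded. After multiplication by a bump function,
integration by parts along the vectors of an orthonormal basis shows that the Fourier transform
decays faster than any power, and Fourier inversion gives smoothness.
-/

noncomputable section

namespace ExternalTangent

/-! ### Smooth curves through converging sequences -/

section SpecialCurve
variable {E : Type*} [NormedAddCommGroup E] [NormedSpace ℝ E]

theorem norm_iteratedFDeriv_rescaled_smul {ρ : ℝ → ℝ} (hρ : ContDiff ℝ ∞ ρ) (a b : ℝ) (z : E)
    (k : ℕ) (t : ℝ) : ‖iteratedFDeriv ℝ k (fun t : ℝ ↦ ρ (a * (t - b)) • z) t‖ =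
      |a| ^ k * ‖iteratedDeriv k ρ (a * (t - b))‖ * ‖z‖ := by
  have h3 : iteratedDeriv k (fun t ↦ ρ (a * (t - b))) t =
      a ^ k * iteratedDeriv k ρ (a * (t - b)) := by
    rw [iteratedDeriv_comp_sub_const k (fun t ↦ ρ (a * t)) b,
      iteratedDeriv_comp_const_mul (hρ.of_le (mod_cast le_top))]
  have h4 : ContDiff ℝ k fun t ↦ ρ (a * (t - b)) :=
    (hρ.comp (by fun_prop : ContDiff ℝ ∞ fun t ↦ a * (t - b))).of_le (mod_cast le_top)
  rw [norm_iteratedFDeriv_eq_norm_iteratedDeriv, iteratedDeriv_smul_const h4.contDiffAt, norm_smul,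
    h3, norm_mul, norm_pow, Real.norm_eq_abs]

/-- The bump at `2⁻ⁿ` has width of order `2⁻ⁿ`, so its `k`-th derivative grows like `2^(kn)`; this
is absorbed by the factorial decay of the coefficients. -/
theorem contDiff_tsum_rescaled_smul [CompleteSpace E] {ρ : ℝ → ℝ} (hρ : ContDiff ℝ ∞ ρ)
    (hc : HasCompactSupport ρ) {z : ℕ → E} (hz : ∀ n, ‖z n‖ ≤ 1 / n.factorial) :
    ContDiff ℝ ∞ fun t : ℝ ↦ ∑' n, ρ (2 ^ (n + 2) * (t - (1 / 2) ^ n)) • z n := by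
  have hb : ∀ k : ℕ, ∃ C, ∀ t, ‖iteratedDeriv k ρ t‖ ≤ C := fun k ↦ by
    obtain ⟨C, hC⟩ := (hc.iteratedFDeriv k).exists_bound_of_continuous
      (hρ.continuous_iteratedFDeriv (𝕜 := ℝ) (m := k) (mod_cast le_top))
    exact ⟨C, fun t ↦ by rw [← norm_iteratedFDeriv_eq_norm_iteratedDeriv]; exact hC t⟩
  choose C hC using hb
  have hs : ∀ k : ℕ, Summable fun n : ℕ ↦
      ((2 : ℝ) ^ k) ^ 2 * C k * (((2 : ℝ) ^ k) ^ n / n.factorial) := fun k ↦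
    (Real.summable_pow_div_factorial _).mul_left _
  have hd : ∀ n : ℕ, ContDiff ℝ ((⊤ : ℕ∞) : WithTop ℕ∞)
      fun t : ℝ ↦ ρ (2 ^ (n + 2) * (t - (1 / 2) ^ n)) • z n := fun n ↦
    (hρ.comp (contDiff_const.mul (contDiff_id.sub contDiff_const))).smul contDiff_const
  refine contDiff_tsum hd (fun k _ ↦ hs k) fun k n t _ ↦ ?_
  rw [norm_iteratedFDeriv_rescaled_smul hρ]
  have h4 : |(2 : ℝ) ^ (n + 2)| ^ k = (2 ^ k) ^ 2 * (2 ^ k) ^ n := by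
    rw [abs_of_pos (by positivity), pow_add, mul_pow, mul_comm, pow_right_comm 2 2 k,
      pow_right_comm 2 n k]
  rw [h4]
  calc (2 ^ k) ^ 2 * (2 ^ k) ^ n * ‖iteratedDeriv k ρ (2 ^ (n + 2) * (t - (1 / 2) ^ n))‖ * ‖z n‖
      ≤ (2 ^ k) ^ 2 * (2 ^ k) ^ n * C k * (1 / n.factorial) := by
        gcongr
        · exact mul_nonneg (by positivity) ((norm_nonneg _).trans (hC k 0))
        · exact hC _ _
        · exact hz n
    _ = _ := by ring

/-- The rescaled bumps are disjoint: a point close to `2⁻ⁿ` is outside the support of the bump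
centred at `2⁻ᵐ` for `m ≠ n`. -/
theorem one_le_abs_rescale {n m : ℕ} (hmn : m ≠ n) {s : ℝ} (hs : |s| < 1 / 2 ^ (n + 3)) :
    1 ≤ |2 ^ (m + 2) * ((1 / 2) ^ n + s - (1 / 2) ^ m)| := by
  obtain ⟨hs1, hs2⟩ := abs_lt.1 hs
  rcases lt_or_gt_of_ne hmn with h | h
  · obtain ⟨k, rfl⟩ := Nat.exists_eq_add_of_lt h
    have e : 2 ^ (m + 2) * ((1 / 2) ^ (m + k + 1) + s - (1 / 2) ^ m) =
        2 * (1 / 2 : ℝ) ^ k + 2 ^ (m + 2) * s - 4 := by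
      simp only [one_div, inv_pow, pow_add]; field_simp; ring
    have h1 : (2 : ℝ) ^ (m + 2) * s ≤ (1 / 2) ^ k * (1 / 4) := by
      calc (2 : ℝ) ^ (m + 2) * s ≤ 2 ^ (m + 2) * (1 / 2 ^ (m + k + 1 + 3)) := by gcongr
        _ = _ := by simp only [one_div, inv_pow, pow_add]; field_simp; norm_num
    have h2 : (1 / 2 : ℝ) ^ k ≤ 1 := pow_le_one₀ (by norm_num) (by norm_num)
    rw [e, le_abs]; right; linarith
  · obtain ⟨k, rfl⟩ := Nat.exists_eq_add_of_lt h
    have e : 2 ^ (n + k + 1 + 2) * ((1 / 2) ^ n + s - (1 / 2) ^ (n + k + 1)) =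
        8 * (2 : ℝ) ^ k + 2 ^ (n + k + 1 + 2) * s - 4 := by
      simp only [one_div, inv_pow, pow_add]; field_simp; ring
    have h1 : -(2 : ℝ) ^ k ≤ 2 ^ (n + k + 1 + 2) * s := by
      calc -(2 : ℝ) ^ k = 2 ^ (n + k + 1 + 2) * (-(1 / 2 ^ (n + 3))) := by
            simp only [one_div, pow_add]; field_simp
        _ ≤ _ := by gcongr
    have h2 : (1 : ℝ) ≤ 2 ^ k := one_le_pow₀ (by norm_num)
    rw [e, le_abs]; left; linarith

/-- **Special curve lemma.** There is a smooth curve passing at time `2⁻ⁿ` through `y n` and moving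
there with constant velocity `w n`. -/
theorem exists_contDiff_curve [CompleteSpace E] {y w : ℕ → E} (hy : ∀ n, ‖y n‖ ≤ 1 / n.factorial)
    (hw : ∀ n, ‖w n‖ ≤ 1 / n.factorial) :
    ∃ c : ℝ → E, ContDiff ℝ ∞ c ∧ c 0 = 0 ∧
      ∀ n, ∀ᶠ s in 𝓝 (0 : ℝ), c ((1 / 2) ^ n + s) = y n + s • w n := by
  let χ : ContDiffBump (0 : ℝ) := ⟨1 / 2, 1, by norm_num, by norm_num⟩
  have hχ : ∀ t : ℝ, 1 ≤ |t| → χ t = 0 := fun t ht ↦ χ.zero_of_le_dist (by simpa using ht)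
  -- `χ (λ (t - b)) • (y + (t - b) • w) = χ (λ (t - b)) • y + ρ (λ (t - b)) • (λ⁻¹ • w)`, so a
  -- bump times an affine map is a sum of two rescaled profiles with constant coefficients.
  let ρ : ℝ → ℝ := fun t ↦ t * χ t
  let z : ℕ → E := fun n ↦ ((1 / 2 : ℝ) ^ (n + 2)) • w n
  have hz : ∀ n, ‖z n‖ ≤ 1 / n.factorial := fun n ↦ by
    rw [norm_smul, Real.norm_of_nonneg (by positivity)]
    exact (mul_le_of_le_one_left (norm_nonneg _) (pow_le_one₀ (by norm_num) (by norm_num))).trans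
      (hw n)
  have hρ : ContDiff ℝ ∞ ρ := contDiff_id.mul χ.contDiff
  have hρc : HasCompactSupport ρ := χ.hasCompactSupport.mul_left
  refine ⟨fun t ↦ (∑' n, χ (2 ^ (n + 2) * (t - (1 / 2) ^ n)) • y n) +
    ∑' n, ρ (2 ^ (n + 2) * (t - (1 / 2) ^ n)) • z n,
    (contDiff_tsum_rescaled_smul χ.contDiff χ.hasCompactSupport hy).add
      (contDiff_tsum_rescaled_smul hρ hρc hz), ?_, fun n ↦ ?_⟩
  · have h0 : ∀ n : ℕ, χ (2 ^ (n + 2) * (0 - (1 / 2) ^ n)) = 0 := fun n ↦ by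
      refine hχ _ ?_
      have : (2 : ℝ) ^ (n + 2) * (0 - (1 / 2) ^ n) = -4 := by
        simp only [one_div, inv_pow, pow_add]; field_simp; norm_num
      rw [this]; norm_num
    simp only [ρ, h0, mul_zero, zero_smul, tsum_zero, add_zero]
  · have hs : ∀ᶠ s in 𝓝 (0 : ℝ), |s| < 1 / 2 ^ (n + 3) :=
      (continuous_abs.tendsto' (0 : ℝ) 0 abs_zero).eventually_lt_const (by positivity)
    filter_upwards [hs] with s hs
    have hm : ∀ m, m ≠ n → χ (2 ^ (m + 2) * ((1 / 2) ^ n + s - (1 / 2) ^ m)) = 0 :=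
      fun m hm ↦ hχ _ (one_le_abs_rescale hm hs)
    have h1 : χ (2 ^ (n + 2) * s) = 1 := by
      refine χ.one_of_mem_closedBall ?_
      rw [mem_closedBall_zero_iff, norm_mul, Real.norm_of_nonneg (by positivity), Real.norm_eq_abs]
      calc (2 : ℝ) ^ (n + 2) * |s| ≤ 2 ^ (n + 2) * (1 / 2 ^ (n + 3)) := by gcongr
        _ = 1 / 2 := by simp only [pow_add]; field_simp
    rw [tsum_eq_single n fun m h ↦ by rw [hm m h, zero_smul],
      tsum_eq_single n fun m h ↦ by simp only [ρ, hm m h, mul_zero, zero_smul]]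
    simp only [add_sub_cancel_left, ρ, h1, one_smul, mul_one, z, smul_smul]
    congr 2
    simp only [one_div, inv_pow]; field_simp

theorem tendsto_half_pow : Filter.Tendsto (fun n : ℕ ↦ (1 / 2 : ℝ) ^ n) Filter.atTop (𝓝 0) :=
  tendsto_pow_atTop_nhds_zero_of_lt_one (by norm_num) (by norm_num)

/-- If `A` were not open at `x`, a smooth curve through `x` and a sequence outside `A` converging to
`x` would have a non-open preimage. -/
theorem isOpen_of_forall_curve [CompleteSpace E] {A : Set E}
    (h : ∀ c : ℝ → E, ContDiff ℝ ∞ c → IsOpen (c ⁻¹' A)) : IsOpen A := by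
  rw [isOpen_iff_mem_nhds]
  intro x hx
  by_contra hA
  have h1 : ∀ n : ℕ, ∃ y, ‖y - x‖ ≤ 1 / n.factorial ∧ y ∉ A := fun n ↦ by
    by_contra! h2
    exact hA (Filter.mem_of_superset (Metric.closedBall_mem_nhds x
      (show (0 : ℝ) < 1 / n.factorial by positivity)) fun y hy ↦ h2 y (by simpa [dist_eq_norm] using hy))
  choose y hy hyA using h1
  obtain ⟨c, hc, hc0, hcn⟩ := exists_contDiff_curve (y := fun n ↦ y n - x) (w := fun _ ↦ 0) hy
    (fun n ↦ by simp)
  have h2 : (fun t ↦ x + c t) ⁻¹' A ∈ 𝓝 (0 : ℝ) :=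
    (h _ (contDiff_const.add hc)).mem_nhds (by simpa [hc0] using hx)
  obtain ⟨n, hn⟩ := (tendsto_half_pow.eventually h2).exists
  have h3 := (hcn n).self_of_nhds
  simp only [add_zero, smul_zero] at h3
  replace hn : x + c ((1 / 2) ^ n) ∈ A := hn
  rw [h3, add_sub_cancel] at hn
  exact hyA n hn

variable {F : Type*} [NormedAddCommGroup F] [NormedSpace ℝ F]

/-- The `p`-th derivative of `f` in the direction `v`. -/
def iteratedLineDeriv (f : E → F) (v : E) (p : ℕ) (x : E) : F :=
  iteratedDeriv p (fun s : ℝ ↦ f (x + s • v)) 0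

/-- If the bound failed, a curve running through a sequence of points with large derivatives, in the
direction `v` and with small speeds, would give an unbounded `p`-th derivative near `0`. -/
theorem iteratedLineDeriv_locally_bounded [CompleteSpace E] {f : E → F}
    (hf : ∀ c : ℝ → E, ContDiff ℝ ∞ c → ContDiff ℝ ∞ (f ∘ c)) (v : E) (p : ℕ) (x : E) :
    ∃ U ∈ 𝓝 x, ∃ C, ∀ y ∈ U, ‖iteratedLineDeriv f v p y‖ ≤ C := by
  by_contra! h
  -- The speeds: `μ n • v` decreases fast enough for the special curve lemma.
  let μ : ℕ → ℝ := fun n ↦ 1 / (n.factorial * (1 + ‖v‖))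
  have hμ : ∀ n, 0 < μ n := fun n ↦ by positivity
  have h1 : ∀ n : ℕ, ∃ y, ‖y - x‖ ≤ 1 / n.factorial ∧
      n / μ n ^ p < ‖iteratedLineDeriv f v p y‖ := fun n ↦ by
    obtain ⟨y, hy, hy'⟩ := h _ (Metric.closedBall_mem_nhds x
      (show (0 : ℝ) < 1 / n.factorial by positivity)) (n / μ n ^ p)
    exact ⟨y, by simpa [dist_eq_norm] using hy, hy'⟩
  choose y hy hyn using h1
  obtain ⟨c, hc, hc0, hcn⟩ := exists_contDiff_curve (y := fun n ↦ y n - x)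
    (w := fun n ↦ μ n • v) hy (fun n ↦ by
      rw [norm_smul, Real.norm_of_nonneg (hμ n).le]
      calc μ n * ‖v‖ ≤ μ n * (1 + ‖v‖) := by gcongr; linarith
        _ = 1 / n.factorial := by simp only [μ]; field_simp)
  have hg : ContDiff ℝ ∞ (f ∘ fun t ↦ x + c t) := hf _ (contDiff_const.add hc)
  have hgn : ∀ n, ‖iteratedDeriv p (f ∘ fun t ↦ x + c t) ((1 / 2) ^ n)‖ =
      μ n ^ p * ‖iteratedLineDeriv f v p (y n)‖ := fun n ↦ by
    have e1 : iteratedDeriv p (f ∘ fun t ↦ x + c t) ((1 / 2) ^ n) =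
        iteratedDeriv p (fun s ↦ (f ∘ fun t ↦ x + c t) ((1 / 2) ^ n + s)) 0 := by
      rw [iteratedDeriv_comp_const_add]; simp
    have e2 : (fun s ↦ (f ∘ fun t ↦ x + c t) ((1 / 2) ^ n + s)) =ᶠ[𝓝 0]
        fun s ↦ (fun s : ℝ ↦ f (y n + s • v)) (μ n * s) := by
      filter_upwards [hcn n] with s hs
      simp only [Function.comp_apply, hs, mul_comm (μ n), mul_smul]
      congr 1; abel
    have e3 : ContDiff ℝ p fun s : ℝ ↦ f (y n + s • v) :=
      (hf (fun s ↦ y n + s • v) (by fun_prop)).of_le (mod_cast le_top)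
    rw [e1, e2.iteratedDeriv_eq, iteratedDeriv_comp_const_smul e3, norm_smul]
    simp [iteratedLineDeriv, abs_of_pos (hμ n)]
  have hlim := ((hg.continuous_iteratedDeriv p (mod_cast le_top)).norm.tendsto 0).comp
    tendsto_half_pow
  refine not_tendsto_nhds_of_tendsto_atTop (Filter.tendsto_atTop_mono (fun n ↦ ?_)
    tendsto_natCast_atTop_atTop) _ hlim
  have := hyn n
  rw [div_lt_iff₀ (pow_pos (hμ n) p)] at this
  simp only [Function.comp_apply, hgn]
  linarith

theorem hasLineDerivAt_iteratedLineDeriv {f : E → F}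
    (hf : ∀ c : ℝ → E, ContDiff ℝ ∞ c → ContDiff ℝ ∞ (f ∘ c)) (v : E) (p : ℕ) (x : E) :
    HasLineDerivAt ℝ (iteratedLineDeriv f v p) (iteratedLineDeriv f v (p + 1) x) x v := by
  have hg : ContDiff ℝ ∞ fun s : ℝ ↦ f (x + s • v) := hf (fun s ↦ x + s • v) (by fun_prop)
  have h1 : (fun t : ℝ ↦ iteratedLineDeriv f v p (x + t • v)) =
      iteratedDeriv p fun s : ℝ ↦ f (x + s • v) := by
    ext t
    have := congrFun (iteratedDeriv_comp_const_add (𝕜 := ℝ) p (fun s : ℝ ↦ f (x + s • v)) t) 0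
    simpa [iteratedLineDeriv, add_smul, add_assoc] using this
  unfold HasLineDerivAt
  rw [h1, iteratedLineDeriv, iteratedDeriv_succ]
  exact ((hg.differentiable_iteratedDeriv p (mod_cast WithTop.coe_lt_top _)) 0).hasDerivAt

end SpecialCurve

/-! ### Smoothness from decay of the Fourier transform -/

section Fourier
open MeasureTheory Real FourierTransform RealInnerProductSpace

variable {E : Type*} [NormedAddCommGroup E] [InnerProductSpace ℝ E] [FiniteDimensional ℝ E]
  [MeasurableSpace E] [BorelSpace E]

/-- Only the existence of the derivative along the single direction `v` is required; `f` need not be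
differentiable. -/
theorem fourier_of_hasLineDerivAt {f f' : E → ℂ} {v : E} (hf : Integrable f) (hf' : Integrable f')
    (h : ∀ x, HasLineDerivAt ℝ f (f' x) x v) (ξ : E) :
    𝓕 f' ξ = (2 * π * Complex.I * ⟪v, ξ⟫) * 𝓕 f ξ := by
  let g (x : E) : ℂ := 𝐞 (-⟪x, ξ⟫)
  have hg : ∀ x, HasLineDerivAt ℝ g (-(2 * π * Complex.I * ⟪v, ξ⟫) * g x) x v := fun x ↦ by
    have h1 : DifferentiableAt ℝ g x :=
      (Real.differentiable_fourierChar_neg_bilinear_left (innerSL ℝ) ξ).differentiableAt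
    have h2 : fderiv ℝ g x v = -2 * π * Complex.I * ⟪v, ξ⟫ * g x :=
      Real.fderiv_fourierChar_neg_bilinear_left_apply (innerSL ℝ) x v ξ
    have h3 := h1.hasFDerivAt.hasLineDerivAt v
    rw [h2] at h3
    convert h3 using 1
    ring
  have i1 : Integrable fun x ↦ g x * f' x := (fourierIntegral_convergent_iff (V := E) ξ).2 hf'
  have i2 : Integrable fun x ↦ g x * f x := (fourierIntegral_convergent_iff (V := E) ξ).2 hf
  have i3 : Integrable fun x ↦ (-(2 * π * Complex.I * ⟪v, ξ⟫) * g x) * f x := by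
    simpa only [mul_assoc] using i2.const_mul (-(2 * π * Complex.I * ⟪v, ξ⟫))
  have key := integral_bilinear_hasLineDerivAt_right_eq_neg_left_of_integrable (μ := volume)
    (B := ContinuousLinearMap.mul ℝ ℂ) i3 i1 i2 (fun x _ ↦ hg x) (fun x _ ↦ h x)
  simp only [ContinuousLinearMap.mul_apply'] at key
  calc 𝓕 f' ξ = ∫ x, g x * f' x := rfl
    _ = (2 * π * Complex.I * ⟪v, ξ⟫) * ∫ x, g x * f x := by
      rw [key, ← integral_neg, ← integral_const_mul]
      congr 1; ext x; ring
    _ = _ := rfl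

theorem abs_inner_pow_mul_norm_fourier_le {D : ℕ → E → ℂ} {v : E} (hD : ∀ p, Integrable (D p))
    (h : ∀ p x, HasLineDerivAt ℝ (D p) (D (p + 1) x) x v) (p : ℕ) (ξ : E) :
    |⟪v, ξ⟫| ^ p * ‖𝓕 (D 0) ξ‖ ≤ ∫ x, ‖D p x‖ := by
  have h1 : ∀ p, 𝓕 (D p) ξ = (2 * π * Complex.I * ⟪v, ξ⟫) ^ p * 𝓕 (D 0) ξ := fun p ↦ by
    induction p with
    | zero => simp
    | succ p ih => rw [fourier_of_hasLineDerivAt (hD p) (hD (p + 1)) (h p), ih]; ring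
  calc |⟪v, ξ⟫| ^ p * ‖𝓕 (D 0) ξ‖ ≤ (2 * π * |⟪v, ξ⟫|) ^ p * ‖𝓕 (D 0) ξ‖ := by
        gcongr
        exact le_mul_of_one_le_left (abs_nonneg _) (by linarith [Real.pi_gt_three])
    _ = ‖𝓕 (D p) ξ‖ := by
        rw [h1 p]; simp [abs_of_pos Real.pi_pos]
    _ ≤ _ := VectorFourier.norm_fourierIntegral_le_integral_norm _ _ _ _ _

/-- All moments of `𝓕 f` are finite, so the Fourier transform of `𝓕 f` is smooth, and `f` is recovered
from it by Fourier inversion. -/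
theorem contDiff_of_fourier_decay {f : E → ℂ} (hf : Continuous f) (hfi : Integrable f)
    (h : ∀ N : ℕ, ∃ C, ∀ ξ, ‖ξ‖ ^ N * ‖𝓕 f ξ‖ ≤ C) : ContDiff ℝ ∞ f := by
  have hc : Continuous (𝓕 f) := VectorFourier.fourierIntegral_continuous
    Real.continuous_fourierChar (innerSL ℝ).continuous₂ hfi
  have hi : ∀ N : ℕ, Integrable fun ξ ↦ ‖ξ‖ ^ N * ‖𝓕 f ξ‖ := fun N ↦ by
    -- Decay of order `N + r`, with `r` above the dimension, makes the `N`-th moment integrable.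
    let r := Module.finrank ℝ E + 1
    obtain ⟨C₁, h₁⟩ := h N
    obtain ⟨C₂, h₂⟩ := h (N + r)
    have hr : Integrable fun ξ : E ↦ (1 + ‖ξ‖) ^ (-(r : ℝ)) :=
      integrable_one_add_norm (by simp [r])
    refine (hr.const_mul (2 ^ r * (C₁ + C₂))).mono' (by fun_prop) (.of_forall fun ξ ↦ ?_)
    rw [Real.norm_of_nonneg (by positivity), Real.rpow_neg (by positivity), Real.rpow_natCast,
      ← div_eq_mul_inv, le_div_iff₀ (by positivity)]
    calc ‖ξ‖ ^ N * ‖𝓕 f ξ‖ * (1 + ‖ξ‖) ^ r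
        ≤ ‖ξ‖ ^ N * ‖𝓕 f ξ‖ * (2 ^ (r - 1) * (1 ^ r + ‖ξ‖ ^ r)) := by
          gcongr; exact add_pow_le zero_le_one (norm_nonneg _) r
      _ ≤ ‖ξ‖ ^ N * ‖𝓕 f ξ‖ * (2 ^ r * (1 ^ r + ‖ξ‖ ^ r)) := by
          gcongr
          · norm_num
          · omega
      _ = 2 ^ r * (‖ξ‖ ^ N * ‖𝓕 f ξ‖ + ‖ξ‖ ^ (N + r) * ‖𝓕 f ξ‖) := by rw [pow_add]; ring
      _ ≤ 2 ^ r * (C₁ + C₂) := by gcongr; exacts [h₁ ξ, h₂ ξ]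
  have h0 : Integrable (𝓕 f) := by
    rw [← integrable_norm_iff hc.aestronglyMeasurable]
    simpa using hi 0
  have h1 : ContDiff ℝ ∞ (𝓕 (𝓕 f)) := Real.contDiff_fourier fun n _ ↦ hi n
  rw [← hf.fourierInv_fourier_eq hfi h0]
  have h2 : 𝓕⁻ (𝓕 f) = fun x ↦ 𝓕 (𝓕 f) (-x) := funext fun x ↦ Real.fourierInv_eq_fourier_neg _ x
  rw [h2]
  exact h1.comp contDiff_neg

/-- A function with integrable pure derivatives of all orders along an orthonormal basis is smooth.
The maps `D i p` are the `p`-th derivatives along `b i`; no mixed derivatives and no continuity of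
the derivatives are needed. -/
theorem contDiff_of_iterated_lineDeriv {ι : Type*} [Fintype ι] (b : OrthonormalBasis ι ℝ E)
    {f : E → ℂ} (hf : Continuous f) (hfi : Integrable f) (D : ι → ℕ → E → ℂ) (hD0 : ∀ i, D i 0 = f)
    (hD : ∀ i p, Integrable (D i p))
    (h : ∀ i p x, HasLineDerivAt ℝ (D i p) (D i (p + 1) x) x (b i)) : ContDiff ℝ ∞ f := by
  refine contDiff_of_fourier_decay hf hfi fun N ↦ ?_
  rcases N.eq_zero_or_pos with rfl | hN
  · exact ⟨_, fun ξ ↦ by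
      rw [pow_zero, one_mul]
      exact VectorFourier.norm_fourierIntegral_le_integral_norm _ _ _ f ξ⟩
  obtain ⟨N, rfl⟩ := Nat.exists_eq_succ_of_ne_zero hN.ne'
  refine ⟨(Finset.univ : Finset ι).card ^ N * ∑ i, ∫ x, ‖D i (N + 1) x‖, fun ξ ↦ ?_⟩
  have h1 : ‖ξ‖ ≤ ∑ i, |⟪b i, ξ⟫| := by
    conv_lhs => rw [← b.sum_repr' ξ]
    refine (norm_sum_le _ _).trans (Finset.sum_le_sum fun i _ ↦ ?_)
    rw [norm_smul, b.norm_eq_one, mul_one, Real.norm_eq_abs]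
  calc ‖ξ‖ ^ (N + 1) * ‖𝓕 f ξ‖ ≤ (∑ i, |⟪b i, ξ⟫|) ^ (N + 1) * ‖𝓕 f ξ‖ := by gcongr
    _ ≤ ((Finset.univ : Finset ι).card ^ N * ∑ i, |⟪b i, ξ⟫| ^ (N + 1)) * ‖𝓕 f ξ‖ := by
        gcongr
        exact pow_sum_le_card_mul_sum_pow (fun i _ ↦ abs_nonneg _) N
    _ = (Finset.univ : Finset ι).card ^ N * ∑ i, |⟪b i, ξ⟫| ^ (N + 1) * ‖𝓕 f ξ‖ := by
        rw [mul_assoc, Finset.sum_mul]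
    _ ≤ _ := by
        gcongr with i
        simpa only [hD0] using abs_inner_pow_mul_norm_fourier_le (hD i) (h i) (N + 1) ξ

end Fourier

/-! ### Boman's theorem -/

section Boman
open MeasureTheory
variable {E : Type*} [NormedAddCommGroup E] [InnerProductSpace ℝ E] [FiniteDimensional ℝ E]

theorem continuous_of_forall_curve {F : Type*} [NormedAddCommGroup F] [NormedSpace ℝ F] {f : E → F}
    (hf : ∀ c : ℝ → E, ContDiff ℝ ∞ c → ContDiff ℝ ∞ (f ∘ c)) : Continuous f := by
  have : CompleteSpace E := FiniteDimensional.complete ℝ E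
  exact continuous_def.2 fun U hU ↦ isOpen_of_forall_curve fun c hc ↦
    hU.preimage (hf c hc).continuous

theorem contDiff_of_forall_curve_of_hasCompactSupport {f : E → ℂ} (hs : HasCompactSupport f)
    (hf : ∀ c : ℝ → E, ContDiff ℝ ∞ c → ContDiff ℝ ∞ (f ∘ c)) : ContDiff ℝ ∞ f := by
  have : CompleteSpace E := FiniteDimensional.complete ℝ E
  borelize E
  have hc := continuous_of_forall_curve hf
  have hD0 : ∀ v, iteratedLineDeriv f v 0 = f := fun v ↦ by
    ext x; simp [iteratedLineDeriv]
  -- The derivatives are not yet known to be continuous, but they are limits of difference quotients.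
  have hm : ∀ v p, Measurable (iteratedLineDeriv f v p) := fun v p ↦ by
    induction p with
    | zero => rw [hD0]; exact hc.measurable
    | succ p ih =>
      have hu : Filter.Tendsto (fun n : ℕ ↦ (1 / ((n : ℝ) + 1))) Filter.atTop (𝓝[≠] 0) :=
        tendsto_nhdsWithin_iff.2 ⟨tendsto_one_div_add_atTop_nhds_zero_nat,
          .of_forall fun n ↦ (by positivity : (1 / ((n : ℝ) + 1)) ≠ 0)⟩
      refine measurable_of_tendsto_metrizable (f := fun (n : ℕ) x ↦ (1 / ((n : ℝ) + 1))⁻¹ •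
        (iteratedLineDeriv f v p (x + (1 / ((n : ℝ) + 1)) • v) - iteratedLineDeriv f v p x))
        (fun n ↦ ?_) (tendsto_pi_nhds.2 fun x ↦ ?_)
      · exact ((ih.comp (measurable_id.add_const _)).sub ih).const_smul ((1 / ((n : ℝ) + 1))⁻¹)
      · have := (hasLineDerivAt_iteratedLineDeriv hf v p x).tendsto_slope_zero.comp hu
        simpa [Function.comp_def] using this
  have hsupp : ∀ v p, Function.support (iteratedLineDeriv f v p) ⊆ tsupport f := fun v p x hx ↦ by
    by_contra h
    refine hx ?_
    have h1 : ∀ᶠ s : ℝ in 𝓝 0, x + s • v ∈ (tsupport f)ᶜ :=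
      (by fun_prop : Continuous fun s : ℝ ↦ x + s • v).continuousAt.eventually_mem
        ((isClosed_tsupport f).isOpen_compl.mem_nhds (by simpa using h))
    have h2 : (fun s : ℝ ↦ f (x + s • v)) =ᶠ[𝓝 0] fun _ ↦ 0 :=
      h1.mono fun s hs ↦ image_eq_zero_of_notMem_tsupport hs
    rw [iteratedLineDeriv, h2.iteratedDeriv_eq]
    simp
  have hb : ∀ v p, ∃ C, ∀ x ∈ tsupport f, ‖iteratedLineDeriv f v p x‖ ≤ C := fun v p ↦ by
    refine hs.isCompact.induction_on (p := fun S ↦ ∃ C, ∀ x ∈ S, ‖iteratedLineDeriv f v p x‖ ≤ C)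
      ⟨0, by simp⟩ (fun S T hST ⟨C, hC⟩ ↦ ⟨C, fun x hx ↦ hC x (hST hx)⟩)
      (fun S T ⟨C, hC⟩ ⟨C', hC'⟩ ↦ ⟨max C C', ?_⟩) fun x _ ↦ ?_
    · rintro x (hx | hx)
      exacts [(hC x hx).trans (le_max_left _ _), (hC' x hx).trans (le_max_right _ _)]
    · obtain ⟨U, hU, h⟩ := iteratedLineDeriv_locally_bounded hf v p x
      exact ⟨U, mem_nhdsWithin_of_mem_nhds hU, h⟩
  have hi : ∀ v p, Integrable (iteratedLineDeriv f v p) := fun v p ↦ by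
    rw [← integrableOn_iff_integrable_of_support_subset (hsupp v p)]
    obtain ⟨C, hC⟩ := hb v p
    exact Measure.integrableOn_of_bounded hs.isCompact.measure_lt_top.ne
      (hm v p).aestronglyMeasurable
      ((ae_restrict_iff' hs.isCompact.measurableSet).2 (.of_forall hC))
  exact contDiff_of_iterated_lineDeriv (stdOrthonormalBasis ℝ E) hc (hD0 0 ▸ hi 0 0)
    (fun i ↦ iteratedLineDeriv f (stdOrthonormalBasis ℝ E i)) (fun i ↦ hD0 _) (fun i ↦ hi _)
    fun i p x ↦ hasLineDerivAt_iteratedLineDeriv hf _ p x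

/-- **Boman's theorem.** -/
theorem contDiff_of_forall_curve {f : E → ℝ}
    (hf : ∀ c : ℝ → E, ContDiff ℝ ∞ c → ContDiff ℝ ∞ (f ∘ c)) : ContDiff ℝ ∞ f := by
  rw [contDiff_iff_contDiffAt]
  intro x
  let χ : ContDiffBump x := ⟨1, 2, by norm_num, by norm_num⟩
  have h1 : ContDiff ℝ ∞ fun y ↦ ((χ y * f y : ℝ) : ℂ) := by
    refine contDiff_of_forall_curve_of_hasCompactSupport ?_ fun c hc ↦ ?_
    · exact (χ.hasCompactSupport.mul_right (f' := f)).comp_left Complex.ofReal_zero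
    · exact Complex.ofRealCLM.contDiff.comp ((χ.contDiff.comp hc).mul (hf c hc))
  refine (Complex.reCLM.contDiff.comp h1).contDiffAt.congr_of_eventuallyEq ?_
  filter_upwards [χ.eventuallyEq_one] with y hy
  simp [hy]

end Boman

/-! ### Bijections with the same smooth curves -/

section Curves

attribute [local instance] prodDiffeology

variable {X Y : Type*} [DiffeologicalSpace X] [DiffeologicalSpace Y]

/-- Boman's theorem for diffeological spaces. -/
theorem dSmooth_of_forall_curve {h : X → ℝ}
    (H : ∀ c : ℝ → X, DSmooth c → DSmooth (h ∘ c)) : DSmooth h := fun _ p hp ↦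
  (contDiff_of_forall_curve fun γ hγ ↦
    (H (p ∘ γ) (hp.dSmooth.comp hγ.dSmooth)).contDiff).isPlot

theorem isOpen_preimage_curve {u : Set X} (hu : IsOpen[DiffeologicalSpace.dTopology] u)
    {c : ℝ → X} (hc : DSmooth c) : IsOpen (c ⁻¹' u) := by
  rw [← IsDTopologyCompatible.dTop_eq ℝ]
  exact @IsOpen.preimage ℝ X DiffeologicalSpace.dTopology DiffeologicalSpace.dTopology
    c hc.continuous u hu

theorem isOpen_dTopology_of_forall_curve {u : Set X}
    (H : ∀ c : ℝ → X, DSmooth c → IsOpen (c ⁻¹' u)) : IsOpen[DiffeologicalSpace.dTopology] u :=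
  isOpen_iff_preimages_plots.2 fun _ p hp ↦ isOpen_of_forall_curve fun γ hγ ↦
    H (p ∘ γ) (hp.dSmooth.comp hγ.dSmooth)

variable {f : X → Y} {g : Y → X} {x : X}

/-- The inverse of `f` preserves smooth curves. -/
theorem dSmooth_inverse_comp_curve (hfg : Function.RightInverse g f)
    (hcurve : ∀ c : ℝ → X, DSmooth (f ∘ c) → DSmooth c) {c : ℝ → Y} (hc : DSmooth c) :
    DSmooth (g ∘ c) :=
  hcurve _ (by rwa [← Function.comp_assoc, hfg.comp_eq_id])

/-- The image under `f` of a `D`-open neighbourhood, written as its preimage under the inverse `g`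
of `f`. The map `g` need not be smooth, but it sends smooth curves to smooth curves. -/
def DOpenNhd.image (hgf : Function.LeftInverse g f) (hfg : Function.RightInverse g f)
    (hcurve : ∀ c : ℝ → X, DSmooth (f ∘ c) → DSmooth c) (B : DOpenNhd X x) :
    DOpenNhd Y (f x) where
  carrier := g ⁻¹' B.carrier
  isOpen := isOpen_dTopology_of_forall_curve fun _ hc ↦
    isOpen_preimage_curve B.isOpen (dSmooth_inverse_comp_curve hfg hcurve hc)
  mem := by simpa only [Set.mem_preimage, hgf x] using B.mem

/-- Transport of smooth functions along a bijection `f` with inverse `g` that has the same smooth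
curves: `h ↦ h ∘ g`. -/
def smoothFunctions.transport (hgf : Function.LeftInverse g f) (hfg : Function.RightInverse g f)
    (hcurve : ∀ c : ℝ → X, DSmooth (f ∘ c) → DSmooth c) (B : DOpenNhd X x)
    (h : smoothFunctions B.carrier) : smoothFunctions (B.image hgf hfg hcurve).carrier :=
  ⟨fun y ↦ h.1 ⟨g y.1, y.2⟩, dSmooth_of_forall_curve fun c hc ↦
    DSmooth.comp (f := fun t ↦ (⟨g (c t).1, (c t).2⟩ : B.carrier)) h.2
      (dSmooth_inverse_comp_curve hfg hcurve (c := Subtype.val ∘ c) hc)⟩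

/-- Smoothness of a map into a functional diffeology is smoothness of a real-valued function on
`ℝⁿ × B`, so it can be tested along curves, which `g` preserves. -/
theorem smoothFunctions.dSmooth_transport (hgf : Function.LeftInverse g f)
    (hfg : Function.RightInverse g f) (hcurve : ∀ c : ℝ → X, DSmooth (f ∘ c) → DSmooth c)
    (B : DOpenNhd X x) : DSmooth (smoothFunctions.transport hgf hfg hcurve B) := by
  intro n q hq
  refine dSmooth_of_forall_curve fun c hc ↦ ?_
  have h1 : DSmooth fun t ↦ (c t).1 := fun m p hp ↦ (hc m p hp).1
  have h2 : DSmooth fun t ↦ ((c t).2 : Y) := fun m p hp ↦ (hc m p hp).2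
  have h3 := dSmooth_inverse_comp_curve hfg hcurve h2
  have h4 : DSmooth fun t ↦ ((c t).1, (⟨g (c t).2.1, (c t).2.2⟩ : B.carrier)) :=
    fun m p hp ↦ ⟨h1 m p hp, h3 m p hp⟩
  exact DSmooth.comp (g := fun z : EuclideanSpace ℝ (Fin n) × B.carrier ↦ (q z.1).1 z.2) hq h4

/-- Transport of functions along `g` is a right inverse of pullback of germs. -/
theorem Germs.pullback_mk_transport (hf : DSmooth f) (hgf : Function.LeftInverse g f)
    (hfg : Function.RightInverse g f) (hcurve : ∀ c : ℝ → X, DSmooth (f ∘ c) → DSmooth c)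
    (B : DOpenNhd X x) (h : smoothFunctions B.carrier) :
    Germs.pullback f hf x (Germs.mk _ (smoothFunctions.transport hgf hfg hcurve B h)) =
      Germs.mk B h := by
  have hB : B.carrier ⊆ f ⁻¹' (g ⁻¹' B.carrier) := fun y hy ↦ by
    simpa only [Set.mem_preimage, hgf y] using hy
  rw [Germs.pullback_mk, Germs.mk_eq_mk_iff]
  refine ⟨B, hB, le_rfl, Subtype.ext (funext fun y ↦ ?_)⟩
  exact congrArg h.1 (Subtype.ext (hgf y.1))

theorem Germs.pullback_injective (hf : DSmooth f) (hgf : Function.LeftInverse g f)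
    (hfg : Function.RightInverse g f) (hcurve : ∀ c : ℝ → X, DSmooth (f ∘ c) → DSmooth c) :
    Function.Injective (Germs.pullback f hf x) := by
  intro a b hab
  obtain ⟨B, φ, rfl⟩ := Germs.exists_mk a
  obtain ⟨C, ψ, rfl⟩ := Germs.exists_mk b
  rw [Germs.pullback_mk, Germs.pullback_mk, Germs.mk_eq_mk_iff] at hab
  obtain ⟨D, hB, hC, h⟩ := hab
  rw [Germs.mk_eq_mk_iff]
  have hB' : g ⁻¹' D.carrier ⊆ B.carrier := fun y hy ↦ by
    have := hB hy
    rwa [DOpenNhd.preimage, Set.mem_preimage, hfg y] at this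
  have hC' : g ⁻¹' D.carrier ⊆ C.carrier := fun y hy ↦ by
    have := hC hy
    rwa [DOpenNhd.preimage, Set.mem_preimage, hfg y] at this
  refine ⟨D.image hgf hfg hcurve, hB', hC', Subtype.ext (funext fun y ↦ ?_)⟩
  have h1 := congrFun (congrArg Subtype.val h) ⟨g y.1, y.2⟩
  have e1 : φ.1 ⟨f (g y.1), hB y.2⟩ = φ.1 ⟨y.1, hB' y.2⟩ := congrArg φ.1 (Subtype.ext (hfg y.1))
  have e2 : ψ.1 ⟨f (g y.1), hC y.2⟩ = ψ.1 ⟨y.1, hC' y.2⟩ := congrArg ψ.1 (Subtype.ext (hfg y.1))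
  exact e1.symm.trans (h1.trans e2)

/-- Pullback of germs along `f` is bijective with smooth inverse, so derivations of one germ algebra
correspond to derivations of the other. -/
theorem ExternalTangentSpace.map_bijective (hf : DSmooth f) (hgf : Function.LeftInverse g f)
    (hfg : Function.RightInverse g f) (hcurve : ∀ c : ℝ → X, DSmooth (f ∘ c) → DSmooth c) (x : X) :
    Function.Bijective (ExternalTangentSpace.map f hf x) := by
  have hinj : Function.Injective (Germs.pullback f hf x) :=
    Germs.pullback_injective hf hgf hfg hcurve
  have hsurj : Function.Surjective (Germs.pullback f hf x) := fun a ↦ by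
    obtain ⟨B, h, rfl⟩ := Germs.exists_mk a
    exact ⟨_, Germs.pullback_mk_transport hf hgf hfg hcurve B h⟩
  refine ⟨fun F G h ↦ ?_, fun G ↦ ?_⟩
  · refine Subtype.ext (LinearMap.ext fun a ↦ ?_)
    obtain ⟨b, rfl⟩ := hsurj a
    exact LinearMap.congr_fun (congrArg Subtype.val h) b
  · let e := LinearEquiv.ofBijective (Germs.pullback f hf x).toLinearMap ⟨hinj, hsurj⟩
    have he : ∀ b, e.symm (Germs.pullback f hf x b) = b := fun b ↦ e.symm_apply_apply b
    have hes : DSmooth e.symm := Germs.dSmooth_of_mk fun B ↦ by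
      have : e.symm ∘ Germs.mk B =
          Germs.mk _ ∘ smoothFunctions.transport hgf hfg hcurve B := by
        ext h
        exact e.symm_apply_eq.2 (Germs.pullback_mk_transport hf hgf hfg hcurve B h).symm
      rw [this]
      exact (Germs.dSmooth_mk _).comp (smoothFunctions.dSmooth_transport hgf hfg hcurve B)
    refine ⟨⟨G.1 ∘ₗ e.symm.toLinearMap, DSmooth.comp (g := G.1) G.2.1 hes, fun a b ↦ ?_⟩,
      Subtype.ext (LinearMap.ext fun a ↦ congrArg G.1 (he a))⟩
    obtain ⟨a, rfl⟩ := hsurj a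
    obtain ⟨b, rfl⟩ := hsurj b
    simp only [LinearMap.comp_apply, LinearEquiv.coe_coe, ← map_mul, he, G.2.2,
      Germs.eval_pullback]

end Curves

/-! ### The diffeology generated by the smooth curves -/

namespace CurveGenerated

variable {X Y : Type*} [DiffeologicalSpace X] [DiffeologicalSpace Y]

/-- The smooth curves of `X` are among the generators of the diffeology of `X'`. -/
theorem dSmooth_curve {c : ℝ → CurveGenerated X} (hc : DSmooth (toOriginal X ∘ c)) :
    DSmooth c := by
  have h1 : IsPlot fun t : EuclideanSpace ℝ (Fin 1) ↦ c (t 0) :=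
    DiffeologicalSpace.isPlot_generatedFrom_of_mem (X := X) ⟨toOriginal X ∘ c, hc, rfl⟩
  have h2 : DSmooth fun t : ℝ ↦ (EuclideanSpace.single 0 t : EuclideanSpace ℝ (Fin 1)) :=
    ContDiff.dSmooth (contDiff_euclidean.2 fun i ↦ by
      simp only [Subsingleton.elim i 0, PiLp.single_apply, if_true]
      exact contDiff_id)
  have h3 : c = (fun t : EuclideanSpace ℝ (Fin 1) ↦ c (t 0)) ∘
      fun t : ℝ ↦ (EuclideanSpace.single 0 t : EuclideanSpace ℝ (Fin 1)) := by
    ext t; simp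
  rw [h3]
  exact h1.dSmooth.comp h2

theorem dSmooth_of_forall_curve {φ : CurveGenerated X → Y}
    (hφ : ∀ c : ℝ → X, DSmooth c → DSmooth fun t ↦ φ (c t)) : DSmooth φ := fun _ _ hp ↦ by
  refine hp (inducedDiffeology φ) ?_
  rintro _ ⟨c, hc, rfl⟩
  exact (hφ c hc) 1 (fun t ↦ t 0) (ContDiff.isPlot (by fun_prop))

end CurveGenerated
end ExternalTangent
end

theorem mainTheorem2 {X : Type*} [DiffeologicalSpace X] (x : X) :
    Function.Bijective (ExternalTangent.ExternalTangentSpace.map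
      (ExternalTangent.CurveGenerated.toOriginal X)
      ExternalTangent.CurveGenerated.dSmooth_toOriginal x) ∧
    ∀ {Y : Type*} [DiffeologicalSpace Y] (φ : X ≃ Y),
      (∀ c : ℝ → X, Diffeology.DSmooth c ↔ Diffeology.DSmooth (φ ∘ c)) →
      ∃ (hφ : Diffeology.DSmooth (φ ∘ ExternalTangent.CurveGenerated.toOriginal X))
        (e : ExternalTangent.ExternalTangentSpace X x ≃ₗ[ℝ]
          ExternalTangent.ExternalTangentSpace Y (φ x)),
        e.toLinearMap ∘ₗ ExternalTangent.ExternalTangentSpace.map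
            (ExternalTangent.CurveGenerated.toOriginal X)
            ExternalTangent.CurveGenerated.dSmooth_toOriginal x =
          ExternalTangent.ExternalTangentSpace.map
            (φ ∘ ExternalTangent.CurveGenerated.toOriginal X) hφ x := by
  have h₁ := ExternalTangent.ExternalTangentSpace.map_bijective
    (X := ExternalTangent.CurveGenerated X) (Y := X) (g := fun y ↦ y)
    ExternalTangent.CurveGenerated.dSmooth_toOriginal (fun _ ↦ rfl) (fun _ ↦ rfl)
    (fun _ ↦ ExternalTangent.CurveGenerated.dSmooth_curve) x
  refine ⟨h₁, fun {Y} _ φ h ↦ ?_⟩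
  have hφ : Diffeology.DSmooth (φ ∘ ExternalTangent.CurveGenerated.toOriginal X) :=
    ExternalTangent.CurveGenerated.dSmooth_of_forall_curve fun c hc ↦ (h c).1 hc
  have h₂ := ExternalTangent.ExternalTangentSpace.map_bijective
    (X := ExternalTangent.CurveGenerated X) hφ (g := φ.symm)
    φ.symm_apply_apply φ.apply_symm_apply
    (fun c hc ↦ ExternalTangent.CurveGenerated.dSmooth_curve ((h _).2 hc)) x
  refine ⟨hφ, (LinearEquiv.ofBijective _ h₁).symm.trans (LinearEquiv.ofBijective _ h₂),
    LinearMap.ext fun F ↦ ?_⟩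
  exact congrArg (LinearEquiv.ofBijective _ h₂) ((LinearEquiv.ofBijective _ h₁).symm_apply_apply F)
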